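/- Let $N\ge 1$, let $\mathcal X_1,\dots,\mathcal X_N\subset\mathbb R^n$ be compact convex sets whose intersection $\mathcal X=\bigcap_{i=1}^N\mathcal X_i$ has non-empty interior, and let $P^i$ and $P_{\mathcal X}$ denote the Euclidean projections onto $\mathcal X_i$ and $\mathcal X$. Let $Q=[[q_{ij}]]$ be a non-negative doubly stochastic $N\times N$ matrix whose directed graph (with an edge between $i$ and $j$ iff $q_{ij}>0$) is irreducible (there is a directed path from every node to every node) and aperiodic (for every node, the g.c.d. of the lengths of the closed paths through it is one). Let $h^1,\dots,h^N:\mathbb R^n\to\mathbb R^n$ be Lipschitz, and let $a_k,b_k>0$ $(k\ge 0)$ satisfy $a_k=o(b_k)$, $\sum_k a_k=\sum_k b_k=\infty$ and $\sum_k(a_k^2+b_k^2)<\infty$. On a probability space, let the random vectors $z_k^i,y_k^i$ $(1\le i\le N,\ k\ge 0)$ in $\mathbb R^n$ be generated by the algorithm DSA-GD: $z_0^i=0$, the $y_0^i$ are arbitrary random vectors, and $$z_{k+1}^i=P^i\Big(\sum_{j}q_{ij}z_k^j-b_k\big(\sum_{j}q_{ij}z_k^j-y_k^i\big)\Big),\qquad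 y_{k+1}^i=\sum_{j}q_{ij}y_k^j+a_k(z_k^i-y_k^i)+a_k\big(h^i(y_k^i)+M_{k+1}^i\big),$$ where the $M^i_{k+1}$ are integrable random vectors such that, with $\mathcal F_k^i=\sigma(y_\ell^i,M_\ell^i:\ell\le k)$ (the variables $M^i_\ell$ being indexed by $\ell\ge 1$), almost surely $\mathbb E[M_{k+1}^i\mid\mathcal F_k^i]=0$ and $\mathbb E[\|M_{k+1}^i\|^2\mid\mathcal F_k^i]\le K(1+\|y_k^i\|^2)$ for all $k,i$, with a constant $K>0$. Assume that $\sup_{k,i}\|y_k^i\|<\infty$ almost surely. Write $\langle y_k\rangle=\frac1N\sum_{i=1}^N y_k^i$. Then: 1. For every $\bar y\in\mathbb R^n$ and every initial point $(\zeta_0^1,\dots,\zeta_0^N)\in(\mathbb R^n)^N$, the fast iteration with the slow variable frozen at $\bar y$, $$\zeta_{k+1}^i=P^i\Big(\sum_{j}q_{ij}\zeta_k^j-b_k\big(\sum_{j}q_{ij}\zeta_k^j-\bar y\big)\Big),$$ satisfies $\zeta_k^i\to P_{\mathcal X}(\bar y)$ as $k\to\infty$, for all $i$. 2. Almost surely,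 for all $i$, $\|z_k^i-P_{\mathcal X}(\langle y_k\rangle)\|\to 0$ as $k\to\infty$. -/

import Mathlib

open MeasureTheory ProbabilityTheory Filter Topology

/-- `p` is a nearest point of `K` to `x`. -/
def IsNearestPoint {E : Type*} [NormedAddCommGroup E] (K : Set E) (x p : E) : Prop :=
  p ∈ K ∧ ∀ q ∈ K, ‖x - p‖ ≤ ‖x - q‖

/-- The metric projection `P_K(x) = argmin_{p ∈ K} ‖x - p‖`. For a nonempty closed convex `K` in
`ℝⁿ` the minimizer exists and is unique: see `isNearestPoint_proj` and `proj_eq_of_isNearestPoint`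
below. -/
noncomputable def proj {E : Type*} [NormedAddCommGroup E] (K : Set E) (x : E) : E :=
  Classical.epsilon (IsNearestPoint K x)

theorem isNearestPoint_proj {n : ℕ} {K : Set (EuclideanSpace ℝ (Fin n))}
    (hne : K.Nonempty) (hcl : IsClosed K) (x : EuclideanSpace ℝ (Fin n)) :
    IsNearestPoint K x (proj K x) := by
  apply Classical.epsilon_spec (p := IsNearestPoint K x)
  obtain ⟨p, hp, hpx⟩ := hcl.exists_infDist_eq_dist hne x
  refine ⟨p, hp, fun q hq => ?_⟩
  rw [← dist_eq_norm, ← dist_eq_norm, ← hpx]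
  exact Metric.infDist_le_dist_of_mem hq

theorem proj_eq_of_isNearestPoint {n : ℕ} {K : Set (EuclideanSpace ℝ (Fin n))}
    (hcv : Convex ℝ K) {x p : EuclideanSpace ℝ (Fin n)} (hp : IsNearestPoint K x p) :
    proj K x = p := by
  have hq : IsNearestPoint K x (proj K x) :=
    Classical.epsilon_spec (p := IsNearestPoint K x) ⟨p, hp⟩
  have key : ∀ q : EuclideanSpace ℝ (Fin n), IsNearestPoint K x q →
      ∀ w ∈ K, inner ℝ (x - q) (w - q) ≤ 0 := by
    intro q hq
    refine (norm_eq_iInf_iff_real_inner_le_zero hcv hq.1).1 ?_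
    have : Nonempty K := ⟨⟨q, hq.1⟩⟩
    exact le_antisymm (le_ciInf fun w => hq.2 w w.2)
      (ciInf_le (f := fun w : K => ‖x - w‖) ⟨0, by rintro _ ⟨w, rfl⟩; exact norm_nonneg _⟩
        ⟨q, hq.1⟩)
  have h1 := key _ hq p hp.1
  have h2 := key _ hp _ hq.1
  have h3 : inner ℝ (proj K x - p) (proj K x - p) ≤ 0 := by
    have : inner ℝ (proj K x - p) (proj K x - p)
        = inner ℝ (x - proj K x) (p - proj K x) + inner ℝ (x - p) (proj K x - p) := by
      rw [← neg_sub (proj K x) p, inner_neg_right, ← sub_eq_neg_add, ← inner_sub_left]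
      congr 1
      abel
    linarith
  exact sub_eq_zero.1 (inner_self_eq_zero (𝕜 := ℝ).1 (le_antisymm h3 real_inner_self_nonneg))

/-- The node average `⟨u⟩ = (u¹ + ⋯ + u^N) / N` of a stacked vector. -/
noncomputable def nodeAvg {N n : ℕ} (u : Fin N → EuclideanSpace ℝ (Fin n)) :
    EuclideanSpace ℝ (Fin n) :=
  (N : ℝ)⁻¹ • ∑ j, u j

/-- The consensus step `((Q ⊗ I_n) u)^i = ∑_j q_{ij} u^j` on stacked vectors. -/
noncomputable def mix {N n : ℕ} (Q : Matrix (Fin N) (Fin N) ℝ)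
    (u : Fin N → EuclideanSpace ℝ (Fin n)) : Fin N → EuclideanSpace ℝ (Fin n) :=
  fun i => ∑ j, Q i j • u j

/-- The communication graph of `Q` (an edge between `i` and `j` iff `q_{ij} > 0`) is aperiodic:
for every node, the gcd of the lengths of all closed paths through it is one, i.e. `1` is the only
common divisor of these lengths. -/
def IsAperiodicMatrix {N : ℕ} (Q : Matrix (Fin N) (Fin N) ℝ) : Prop :=
  letI : Quiver (Fin N) := Q.toQuiver
  ∀ i : Fin N, ∀ d : ℕ, (∀ p : Quiver.Path i i, d ∣ p.length) → d = 1

/-- One step of the distributed projected gradient descent, for the constraint sets `X i`: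
`z^i ↦ P^i(∑_j q_{ij} z^j - b (∑_j q_{ij} z^j - y^i))`. -/
noncomputable def fastStep {N n : ℕ} (X : Fin N → Set (EuclideanSpace ℝ (Fin n)))
    (Q : Matrix (Fin N) (Fin N) ℝ) (b : ℝ) (z y : Fin N → EuclideanSpace ℝ (Fin n)) :
    Fin N → EuclideanSpace ℝ (Fin n) :=
  fun i => proj (X i) (mix Q z i - b • (mix Q z i - y i))

/-- One step of the distributed stochastic approximation, with noise sample `m`:
`y^i ↦ ∑_j q_{ij} y^j + a (z^i - y^i) + a (h^i(y^i) + m^i)`. -/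
noncomputable def slowStep {N n : ℕ} (Q : Matrix (Fin N) (Fin N) ℝ)
    (h : Fin N → EuclideanSpace ℝ (Fin n) → EuclideanSpace ℝ (Fin n)) (a : ℝ)
    (z y m : Fin N → EuclideanSpace ℝ (Fin n)) : Fin N → EuclideanSpace ℝ (Fin n) :=
  fun i => mix Q y i + a • (z i - y i) + a • (h i (y i) + m i)

/-- The processes `z`, `y` are generated by the algorithm DSA-GD with noise `M`
(the sample used in step `k` is `M (k + 1)`). -/
structure IsDSAGD {Ω : Type*} {N n : ℕ} (X : Fin N → Set (EuclideanSpace ℝ (Fin n)))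
    (Q : Matrix (Fin N) (Fin N) ℝ)
    (h : Fin N → EuclideanSpace ℝ (Fin n) → EuclideanSpace ℝ (Fin n)) (a b : ℕ → ℝ)
    (M z y : ℕ → Ω → Fin N → EuclideanSpace ℝ (Fin n)) : Prop where
  init : ∀ ω i, z 0 ω i = 0
  fast : ∀ k ω, z (k + 1) ω = fastStep X Q (b k) (z k ω) (y k ω)
  slow : ∀ k ω, y (k + 1) ω = slowStep Q h (a k) (z k ω) (y k ω) (M (k + 1) ω)

/-- The `σ`-field `𝓕^i_k = σ(y^i_l, M^i_l : l ≤ k)` of the history of node `i`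
(the noise variables are indexed by `l ≥ 1`). -/
@[reducible] def nodeHistory {Ω : Type*} {N n : ℕ} (M y : ℕ → Ω → Fin N → EuclideanSpace ℝ (Fin n))
    (i : Fin N) (k : ℕ) : MeasurableSpace Ω :=
  (⨆ l : ℕ, ⨆ _ : l ≤ k, MeasurableSpace.comap (fun ω => y l ω i) inferInstance) ⊔
  (⨆ l : ℕ, ⨆ _ : 1 ≤ l ∧ l ≤ k, MeasurableSpace.comap (fun ω => M l ω i) inferInstance)

/-! Both claims are instances of one tracking statement, `tendsto_norm_sub_proj_of_slow_target`: if
a target `x k` moves by `o(b k)` per step and all `y k i` approach it, then every `z k i` approaches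
the projection `p k` of `x k` onto the intersection. A frozen target gives the first claim.

Tracking rests on the Lyapunov function `∑ ‖z^i - p‖² + α β(z)²`. In the first term the gradient
step contracts at rate `b`, up to errors of order `b * osc z`: the mixed points lie within `osc z`
of every `X j`, hence within a multiple of it of the intersection, since the sets share a ball
(`exists_mem_iInter_norm_sub_le`). In the second term `β` dominates the oscillation and contracts at
a fixed rate under `Q` (`exists_consensus_lyapunov`), but is perturbed by the displacement `r` that
gradient step and projection cause; `r` is not a priori `O(b)`. The projection inequality supplies a
term `-r²/2` in the first estimate, which pays for this (`exists_combined_lyapunov`). What remains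
is `U (k+1) ≤ (1 - b k) U k + b k ε k` with `ε k → 0`, which forces `U → 0` because `∑ b k = ∞`.

For the second claim the noise series `∑ a k • M (k+1)` converges almost surely, by truncation and
`L²`-bounded martingales. Subtracting the deviation of its averaged partial sums from their limit
turns `⟨y k⟩` into a target with increments `O(a k) = o(b k)`; consensus of the `y k i` follows from
the same `β`. -/

/-! ### Primitivity of irreducible aperiodic matrices. -/

section Primitive

variable {N : ℕ} {Q : Matrix (Fin N) (Fin N) ℝ}

theorem Matrix.pow_add_apply_pos (hQ : ∀ i j, 0 ≤ Q i j) {k l : ℕ} {i j m : Fin N}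
    (h₁ : 0 < (Q ^ k) i j) (h₂ : 0 < (Q ^ l) j m) : 0 < (Q ^ (k + l)) i m := by
  rw [pow_add, Matrix.mul_apply]
  exact Finset.sum_pos' (fun x _ => mul_nonneg (Matrix.pow_apply_nonneg hQ k i x)
    (Matrix.pow_apply_nonneg hQ l x m)) ⟨j, Finset.mem_univ j, mul_pos h₁ h₂⟩

/-- The return times to a node, as a submonoid of `ℕ`. -/
def returnTimes (hQ : ∀ i j, 0 ≤ Q i j) (i : Fin N) : AddSubmonoid ℕ where
  carrier := {k | 0 < (Q ^ k) i i}
  zero_mem' := by simp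
  add_mem' := fun h₁ h₂ => Matrix.pow_add_apply_pos hQ h₁ h₂

/-- A submonoid of `ℕ` contains all large multiples of its gcd. Lengths of closed paths are return
times, so aperiodicity makes this gcd equal to one. -/
theorem IsAperiodicMatrix.exists_return (hQ : ∀ i j, 0 ≤ Q i j) (hap : IsAperiodicMatrix Q)
    (i : Fin N) : ∃ m, ∀ k ≥ m, 0 < (Q ^ k) i i := by
  obtain ⟨m, hm⟩ := Nat.exists_mem_closure_of_ge (s := (returnTimes hQ i : Set ℕ))
  have hgcd : Nat.setGcd (returnTimes hQ i : Set ℕ) = 1 := by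
    let : Quiver (Fin N) := Q.toQuiver
    refine hap i _ fun p => Nat.setGcd_dvd_of_mem ?_
    exact (Matrix.pow_apply_pos_iff_nonempty_path hQ p.length i i).2 ⟨⟨p, rfl⟩⟩
  refine ⟨m, fun k hk => ?_⟩
  have := hm k hk (by rw [hgcd]; exact one_dvd k)
  rwa [AddSubmonoid.closure_eq] at this

/-- An irreducible aperiodic matrix is primitive. -/
theorem Matrix.IsIrreducible.isPrimitive (hirr : Q.IsIrreducible) (hap : IsAperiodicMatrix Q) :
    Q.IsPrimitive := by
  refine ⟨hirr.nonneg, ?_⟩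
  choose m hm using hap.exists_return hirr.nonneg
  choose k _ hk using (Matrix.isIrreducible_iff_exists_pow_pos hirr.nonneg).1 hirr
  -- One exponent for all pairs: after reserving `k i j` steps for a walk from `i` to `j`, at least
  -- `m i` steps are left to loop at `i`. The `+ 1` keeps the exponent positive.
  refine ⟨∑ i, m i + ∑ i, ∑ j, k i j + 1, by omega, fun i j => ?_⟩
  have h₁ : m i ≤ ∑ i, m i := Finset.single_le_sum (fun _ _ => Nat.zero_le _) (Finset.mem_univ i)
  have h₂ : k i j ≤ ∑ i, ∑ j, k i j :=
    (Finset.single_le_sum (f := k i) (fun _ _ => Nat.zero_le _) (Finset.mem_univ j)).trans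
      (Finset.single_le_sum (f := fun i => ∑ j, k i j) (fun _ _ => Nat.zero_le _)
        (Finset.mem_univ i))
  have := Matrix.pow_add_apply_pos hirr.nonneg
    (hm i (∑ i, m i + ∑ i, ∑ j, k i j + 1 - k i j) (by omega)) (hk i j)
  rwa [Nat.sub_add_cancel (by omega)] at this

end Primitive

/-! ### Oscillation seminorm and contraction under mixing. -/

section Oscillation

variable {N n : ℕ}

/-- The oscillation `max_{i,j} ‖z^i - z^j‖` of a stacked vector. -/
noncomputable def osc (z : Fin N → EuclideanSpace ℝ (Fin n)) : ℝ :=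
  ‖fun p : Fin N × Fin N => z p.1 - z p.2‖

theorem osc_nonneg (z : Fin N → EuclideanSpace ℝ (Fin n)) : 0 ≤ osc z := norm_nonneg _

theorem norm_sub_le_osc (z : Fin N → EuclideanSpace ℝ (Fin n)) (i j : Fin N) :
    ‖z i - z j‖ ≤ osc z :=
  norm_le_pi_norm (fun p : Fin N × Fin N => z p.1 - z p.2) (i, j)

theorem osc_le {z : Fin N → EuclideanSpace ℝ (Fin n)} {c : ℝ} (hc : 0 ≤ c)
    (h : ∀ i j, ‖z i - z j‖ ≤ c) : osc z ≤ c :=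
  (pi_norm_le_iff_of_nonneg hc).2 fun p => h p.1 p.2

theorem osc_add_le (z w : Fin N → EuclideanSpace ℝ (Fin n)) : osc (z + w) ≤ osc z + osc w := by
  refine osc_le (add_nonneg (osc_nonneg z) (osc_nonneg w)) fun i j => ?_
  rw [Pi.add_apply, Pi.add_apply, add_sub_add_comm]
  exact (norm_add_le _ _).trans (add_le_add (norm_sub_le_osc z i j) (norm_sub_le_osc w i j))

theorem osc_le_two_mul_norm (z : Fin N → EuclideanSpace ℝ (Fin n)) : osc z ≤ 2 * ‖z‖ := by
  refine osc_le (by positivity) fun i j => ?_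
  linarith [norm_sub_le (z i) (z j), norm_le_pi_norm z i, norm_le_pi_norm z j]

theorem mix_add (A : Matrix (Fin N) (Fin N) ℝ) (z w : Fin N → EuclideanSpace ℝ (Fin n)) :
    mix A (z + w) = mix A z + mix A w := by
  ext1 i
  simp [mix, Finset.sum_add_distrib]

theorem mix_mul (A B : Matrix (Fin N) (Fin N) ℝ) (z : Fin N → EuclideanSpace ℝ (Fin n)) :
    mix (A * B) z = mix A (mix B z) := by
  ext1 i
  simp only [mix, Matrix.mul_apply, Finset.sum_smul, Finset.smul_sum, smul_smul]
  exact Finset.sum_comm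

theorem mix_one (z : Fin N → EuclideanSpace ℝ (Fin n)) : mix 1 z = z := by
  ext1 i
  simp [mix, Matrix.one_apply, ite_smul]

/-- The row sum `s` is left general because the contraction argument removes mass from a column and
mixes with what remains. -/
theorem norm_mix_sub_smul_le {A : Matrix (Fin N) (Fin N) ℝ} {i : Fin N} {s : ℝ}
    (hA : ∀ j, 0 ≤ A i j) (hs : ∑ j, A i j = s) {z : Fin N → EuclideanSpace ℝ (Fin n)}
    {c : EuclideanSpace ℝ (Fin n)} {r : ℝ} (h : ∀ j, ‖z j - c‖ ≤ r) :
    ‖mix A z i - s • c‖ ≤ s * r := by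
  have : mix A z i - s • c = ∑ j, A i j • (z j - c) := by
    simp [mix, smul_sub, Finset.sum_sub_distrib, ← Finset.sum_smul, hs]
  rw [this, ← hs, Finset.sum_mul]
  refine norm_sum_le_of_le _ fun j _ => ?_
  rw [norm_smul, Real.norm_of_nonneg (hA j)]
  exact mul_le_mul_of_nonneg_left (h j) (hA j)

theorem norm_mix_sub_le {A : Matrix (Fin N) (Fin N) ℝ} {i : Fin N}
    (hA : ∀ j, 0 ≤ A i j) (hs : ∑ j, A i j = 1) {z : Fin N → EuclideanSpace ℝ (Fin n)}
    {c : EuclideanSpace ℝ (Fin n)} {r : ℝ} (h : ∀ j, ‖z j - c‖ ≤ r) : ‖mix A z i - c‖ ≤ r := by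
  simpa using norm_mix_sub_smul_le hA hs h

/-- After division by `s`, row `j` gives a convex combination of the `z l`, hence a point within
`osc z` of each `z l`; row `i` then averages these distances with total weight `s`. -/
theorem osc_mix_le_mul {A : Matrix (Fin N) (Fin N) ℝ} {s : ℝ} (h0 : 0 < s)
    (hA : ∀ i j, 0 ≤ A i j) (hs : ∀ i, ∑ j, A i j = s) (z : Fin N → EuclideanSpace ℝ (Fin n)) :
    osc (mix A z) ≤ s * osc z := by
  refine osc_le (mul_nonneg h0.le (osc_nonneg z)) fun i j => ?_
  have hj : mix A z j = s • (s⁻¹ • mix A z j) := by rw [smul_smul, mul_inv_cancel₀ h0.ne', one_smul]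
  rw [hj]
  refine norm_mix_sub_smul_le (hA i) (hs i) fun l => ?_
  have := norm_mix_sub_smul_le (hA j) (hs j) (c := z l) fun m => norm_sub_le_osc z m l
  have e : z l - s⁻¹ • mix A z j = -(s⁻¹ • (mix A z j - s • z l)) := by
    rw [smul_sub, smul_smul, inv_mul_cancel₀ h0.ne', one_smul, neg_sub]
  rw [e, norm_neg, norm_smul, norm_inv, Real.norm_of_nonneg h0.le, inv_mul_le_iff₀ h0]
  exact this

theorem osc_mix_le {A : Matrix (Fin N) (Fin N) ℝ} (hA : A ∈ doublyStochastic ℝ (Fin N))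
    (z : Fin N → EuclideanSpace ℝ (Fin n)) : osc (mix A z) ≤ osc z := by
  simpa using osc_mix_le_mul one_pos (fun i j => nonneg_of_mem_doublyStochastic hA)
    (sum_row_of_mem_doublyStochastic hA) z

/-- Doeblin's argument: every row puts mass at least `δ` on column `l`. The common summand `δ • z l`
cancels in differences, and the remaining matrix has row sums `1 - δ`. -/
theorem exists_osc_mix_contraction {A : Matrix (Fin N) (Fin N) ℝ} (hN : 0 < N)
    (hA : A ∈ doublyStochastic ℝ (Fin N)) (hpos : ∀ i j, 0 < A i j) :
    ∃ δ : ℝ, 0 < δ ∧ δ < 1 ∧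
      ∀ z : Fin N → EuclideanSpace ℝ (Fin n), osc (mix A z) ≤ (1 - δ) * osc z := by
  let l : Fin N := ⟨0, hN⟩
  have : Nonempty (Fin N) := ⟨l⟩
  obtain ⟨i₀, hi₀⟩ := Finite.exists_min (fun i => A i l)
  have hle : A i₀ l ≤ 1 := le_one_of_mem_doublyStochastic hA
  have h0 : 0 < A i₀ l := hpos i₀ l
  -- Halving the minimum keeps `δ < 1` even for `N = 1`, where the entry equals one.
  refine ⟨A i₀ l / 2, by linarith, by linarith, fun z => ?_⟩
  set δ := A i₀ l / 2 with hδ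
  let B : Matrix (Fin N) (Fin N) ℝ := fun i j => A i j - if j = l then δ else 0
  have hB : ∀ i j, 0 ≤ B i j := fun i j => by
    by_cases hj : j = l
    · subst hj
      have := hi₀ i
      simp only [B, if_true]
      linarith
    · simpa [B, hj] using (hpos i j).le
  have hsum : ∀ i, ∑ j, B i j = 1 - δ := fun i => by
    simp [B, Finset.sum_sub_distrib, sum_row_of_mem_doublyStochastic hA i]
  have hmix : ∀ i, mix A z i = mix B z i + δ • z l := fun i => by
    simp [mix, B, sub_smul, Finset.sum_sub_distrib, ite_smul]
  have hosc : osc (mix A z) = osc (mix B z) := by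
    unfold osc
    congr 1
    ext1 p
    rw [hmix, hmix, add_sub_add_right_eq_sub]
  rw [hosc]
  exact osc_mix_le_mul (by linarith) hB hsum z

/-- A Lyapunov seminorm for the consensus iteration of a primitive doubly stochastic matrix. -/
theorem exists_consensus_lyapunov {Q : Matrix (Fin N) (Fin N) ℝ} (hN : 0 < N)
    (hQ : Q ∈ doublyStochastic ℝ (Fin N)) (hprim : Q.IsPrimitive) :
    ∃ (β : (Fin N → EuclideanSpace ℝ (Fin n)) → ℝ) (c C : ℝ), 0 < c ∧ c ≤ 1 ∧ 0 < C ∧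
      (∀ z, osc z ≤ β z) ∧ ∀ z r, β (mix Q z + r) ≤ (1 - c) * β z + C * ‖r‖ := by
  obtain ⟨m, hm, hpos⟩ := hprim.exists_pos_pow
  have hpow : ∀ s, Q ^ s ∈ doublyStochastic ℝ (Fin N) := fun s => pow_mem hQ s
  obtain ⟨δ, h0, h1, hδ⟩ := exists_osc_mix_contraction (n := n) hN (hpow m) hpos
  -- Summing over `m` steps turns the `m`-step contraction into a one-step one: applying `Q`
  -- replaces the summand `osc z` by `osc (mix (Q ^ m) z)`, a loss of at least `δ * osc z ≥ (δ / m)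
  -- * β z`.
  let β : (Fin N → EuclideanSpace ℝ (Fin n)) → ℝ :=
    fun z => ∑ s ∈ Finset.range m, osc (mix (Q ^ s) z)
  have hmR : (1 : ℝ) ≤ m := by exact_mod_cast hm
  have hle : ∀ z, β z ≤ m * osc z := fun z => by
    refine (Finset.sum_le_sum fun s _ => osc_mix_le (hpow s) z).trans ?_
    simp
  refine ⟨β, δ / m, 2 * m, by positivity, ?_, by positivity, fun z => ?_, fun z r => ?_⟩
  · rw [div_le_one (by linarith)]
    linarith
  · have := Finset.single_le_sum (f := fun s => osc (mix (Q ^ s) z)) (fun s _ => osc_nonneg _)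
      (Finset.mem_range.2 hm)
    simpa [mix_one] using this
  · have hadd : β (mix Q z + r) ≤ β (mix Q z) + β r := by
      simp only [β, ← Finset.sum_add_distrib, mix_add]
      exact Finset.sum_le_sum fun s _ => osc_add_le _ _
    have hstep : β (mix Q z) = β z - osc z + osc (mix (Q ^ m) z) := by
      have h₁ := Finset.sum_range_succ (fun s => osc (mix (Q ^ s) z)) m
      have h₂ := Finset.sum_range_succ' (fun s => osc (mix (Q ^ s) z)) m
      simp only [pow_zero, mix_one, pow_succ, mix_mul] at h₁ h₂
      simp only [β]
      linarith
    have hr : β r ≤ 2 * m * ‖r‖ := by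
      have := mul_le_mul_of_nonneg_left (osc_le_two_mul_norm r) (by linarith : (0 : ℝ) ≤ m)
      linarith [hle r]
    have hz : δ / m * β z ≤ δ * osc z := by
      rw [div_mul_eq_mul_div, div_le_iff₀ (by linarith)]
      have := mul_le_mul_of_nonneg_left (hle z) h0.le
      linarith
    linarith [hδ z]

end Oscillation

/-! ### Metric projections and linear regularity. -/

section Projection

variable {n : ℕ} {K : Set (EuclideanSpace ℝ (Fin n))}

theorem proj_mem (hne : K.Nonempty) (hcl : IsClosed K) (x : EuclideanSpace ℝ (Fin n)) :
    proj K x ∈ K :=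
  (isNearestPoint_proj hne hcl x).1

theorem inner_sub_proj_le_zero (hcv : Convex ℝ K) (hcl : IsClosed K)
    (x : EuclideanSpace ℝ (Fin n)) {q : EuclideanSpace ℝ (Fin n)} (hq : q ∈ K) :
    inner ℝ (x - proj K x) (q - proj K x) ≤ 0 := by
  have hp := isNearestPoint_proj ⟨q, hq⟩ hcl x
  have : Nonempty K := ⟨⟨q, hq⟩⟩
  refine (norm_eq_iInf_iff_real_inner_le_zero hcv hp.1).1 ?_ q hq
  exact le_antisymm (le_ciInf fun w => hp.2 w w.2)
    (ciInf_le (f := fun w : K => ‖x - w‖) ⟨0, by rintro _ ⟨w, rfl⟩; exact norm_nonneg _⟩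
      ⟨_, hp.1⟩)

/-- Obtuse-angle form of Pythagoras. The negative term is kept: it later controls how far a step
moves the mixed points. -/
theorem norm_proj_sub_sq_le (hcv : Convex ℝ K) (hcl : IsClosed K)
    (x : EuclideanSpace ℝ (Fin n)) {q : EuclideanSpace ℝ (Fin n)} (hq : q ∈ K) :
    ‖proj K x - q‖ ^ 2 ≤ ‖x - q‖ ^ 2 - ‖proj K x - x‖ ^ 2 := by
  have h := inner_sub_proj_le_zero hcv hcl x hq
  have e : x - q = (x - proj K x) - (q - proj K x) := by abel
  have := norm_sub_sq_real (x - proj K x) (q - proj K x)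
  rw [← e, norm_sub_rev x (proj K x), norm_sub_rev q (proj K x)] at this
  linarith

theorem norm_proj_sub_proj_le (hne : K.Nonempty) (hcv : Convex ℝ K) (hcl : IsClosed K)
    (x y : EuclideanSpace ℝ (Fin n)) : ‖proj K x - proj K y‖ ≤ ‖x - y‖ := by
  have h₁ := inner_sub_proj_le_zero hcv hcl x (proj_mem hne hcl y)
  have h₂ := inner_sub_proj_le_zero hcv hcl y (proj_mem hne hcl x)
  have h₃ : ‖proj K x - proj K y‖ ^ 2 ≤ inner ℝ (x - y) (proj K x - proj K y) := by
    rw [← real_inner_self_eq_norm_sq]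
    simp only [inner_sub_left, inner_sub_right] at *
    linarith
  have h₄ := real_inner_le_norm (x - y) (proj K x - proj K y)
  nlinarith [norm_nonneg (proj K x - proj K y), norm_nonneg (x - y)]

theorem continuous_proj (hne : K.Nonempty) (hcv : Convex ℝ K) (hcl : IsClosed K) :
    Continuous (proj K) := by
  refine LipschitzWith.continuous (K := 1) (LipschitzWith.of_dist_le_mul fun x y => ?_)
  simpa [dist_eq_norm] using norm_proj_sub_proj_le hne hcv hcl x y

/-- Linear regularity of convex sets that share a ball: a point close to each of the sets is
close to their intersection. -/
theorem exists_mem_iInter_norm_sub_le {ι : Type*} {X : ι → Set (EuclideanSpace ℝ (Fin n))}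
    (hX : ∀ i, Convex ℝ (X i)) {c : EuclideanSpace ℝ (Fin n)} {ρ : ℝ} (hρ : 0 < ρ)
    (hball : Metric.closedBall c ρ ⊆ ⋂ i, X i) {v : EuclideanSpace ℝ (Fin n)} {ε : ℝ}
    (hε : 0 ≤ ε) (hv : ∀ i, ∃ w ∈ X i, ‖v - w‖ ≤ ε) :
    ∃ q ∈ ⋂ i, X i, ‖v - q‖ ≤ ε / ρ * ‖v - c‖ := by
  rcases hε.eq_or_lt with rfl | hε
  · refine ⟨v, Set.mem_iInter.2 fun i => ?_, by simp⟩
    obtain ⟨w, hw, h⟩ := hv i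
    rwa [sub_eq_zero.1 (norm_le_zero_iff.1 h)]
  have hs : 0 < ρ + ε := by linarith
  -- Move `v` towards the centre `c`. For each `i` the same point is a convex combination of `w ∈ X
  -- i` and `c + (ρ / ε) • (v - w)`, and the latter lies in the common ball.
  refine ⟨(ρ / (ρ + ε)) • v + (ε / (ρ + ε)) • c, Set.mem_iInter.2 fun i => ?_, ?_⟩
  · obtain ⟨w, hw, h⟩ := hv i
    have hc : c + (ρ / ε) • (v - w) ∈ X i := by
      refine Set.mem_iInter.1 (hball ?_) i
      rw [mem_closedBall_iff_norm, add_sub_cancel_left, norm_smul,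
        Real.norm_of_nonneg (by positivity), div_mul_eq_mul_div, div_le_iff₀ hε]
      exact mul_le_mul_of_nonneg_left h hρ.le
    have := hX i hw hc (a := ρ / (ρ + ε)) (b := ε / (ρ + ε)) (by positivity) (by positivity)
      (by field_simp)
    have e : ε / (ρ + ε) * (ρ / ε) = ρ / (ρ + ε) := by field_simp
    rw [smul_add, smul_smul, e, smul_sub] at this
    convert this using 1
    abel
  · have e : v - ((ρ / (ρ + ε)) • v + (ε / (ρ + ε)) • c) = (ε / (ρ + ε)) • (v - c) := by
      have : v = (ρ / (ρ + ε) + ε / (ρ + ε)) • v := by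
        rw [← add_div, div_self hs.ne', one_smul]
      nth_rewrite 1 [this]
      rw [add_smul, smul_sub]
      abel
    rw [e, norm_smul, Real.norm_of_nonneg (by positivity)]
    refine mul_le_mul_of_nonneg_right ?_ (norm_nonneg _)
    exact div_le_div_of_nonneg_left hε.le hρ (by linarith)

end Projection

/-! ### Scalar recursions. -/

section Recursion

/-- Nonnegative sequences with `u (k + 1) ≤ (1 - b k) * u k + b k * ε k`, `∑ b k = ∞` and
`ε k → 0` tend to zero. -/
theorem tendsto_zero_of_le_convex_step {u b ε : ℕ → ℝ} (hu : ∀ k, 0 ≤ u k)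
    (hb : ∀ᶠ k in atTop, 0 ≤ b k ∧ b k ≤ 1)
    (hbsum : Tendsto (fun m => ∑ k ∈ Finset.range m, b k) atTop atTop)
    (hε : Tendsto ε atTop (𝓝 0))
    (hrec : ∀ᶠ k in atTop, u (k + 1) ≤ (1 - b k) * u k + b k * ε k) :
    Tendsto u atTop (𝓝 0) := by
  rw [Metric.tendsto_atTop]
  intro δ hδ
  obtain ⟨m, hm⟩ := eventually_atTop.1
    (hb.and (hrec.and (hε.eventually_lt_const (half_pos hδ))))
  let S : ℕ → ℝ := fun k => ∑ l ∈ Finset.range k, b l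
  -- Once `ε k < δ / 2`, the truncated excess over `δ / 2` satisfies the homogeneous recursion, so
  -- it decays like `exp (-∑ b)`.
  let w : ℕ → ℝ := fun k => max (u k - δ / 2) 0
  have hw : ∀ k ≥ m, w k ≤ w m * Real.exp (S m - S k) := by
    intro k hk
    induction k, hk using Nat.le_induction with
    | base => simp
    | succ k hk ih =>
      obtain ⟨⟨hb0, hb1⟩, hr, he⟩ := hm k hk
      have hstep : w (k + 1) ≤ (1 - b k) * w k := by
        refine max_le ?_ (mul_nonneg (by linarith) (le_max_right _ _))
        have h₁ := mul_le_mul_of_nonneg_left (le_max_left (u k - δ / 2) 0)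
          (by linarith : 0 ≤ 1 - b k)
        have h₂ := mul_le_mul_of_nonneg_left he.le hb0
        simp only [w]
        linarith
      have hexp : 1 - b k ≤ Real.exp (-b k) := by
        linarith [Real.add_one_le_exp (-b k)]
      have hS : S m - S (k + 1) = -b k + (S m - S k) := by
        simp only [S, Finset.sum_range_succ]
        ring
      calc w (k + 1) ≤ (1 - b k) * w k := hstep
        _ ≤ Real.exp (-b k) * (w m * Real.exp (S m - S k)) :=
          mul_le_mul hexp ih (le_max_right _ _) (Real.exp_nonneg _)
        _ = w m * Real.exp (S m - S (k + 1)) := by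
          rw [hS, Real.exp_add]
          ring
  have hlim : Tendsto (fun k => w m * Real.exp (S m - S k)) atTop (𝓝 0) := by
    rw [← mul_zero (w m)]
    refine Tendsto.const_mul _ (Real.tendsto_exp_atBot.comp ?_)
    exact tendsto_atBot_add_const_left _ (S m) (tendsto_neg_atTop_atBot.comp hbsum)
  obtain ⟨m', hm'⟩ := eventually_atTop.1 (hlim.eventually_lt_const (half_pos hδ))
  refine ⟨max m m', fun k hk => ?_⟩
  rw [Real.dist_eq, sub_zero, abs_of_nonneg (hu k)]
  have h₁ := hw k (le_of_max_le_left hk)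
  have h₂ := hm' k (le_of_max_le_right hk)
  have h₃ := le_max_left (u k - δ / 2) 0
  simp only [w] at h₁ h₂
  linarith

/-- Linear contraction up to a vanishing perturbation. -/
theorem tendsto_zero_of_le_contraction {u t : ℕ → ℝ} {c : ℝ} (hc : 0 < c) (hc1 : c ≤ 1)
    (hu : ∀ k, 0 ≤ u k) (ht : Tendsto t atTop (𝓝 0))
    (hrec : ∀ k, u (k + 1) ≤ (1 - c) * u k + t k) : Tendsto u atTop (𝓝 0) := by
  refine tendsto_zero_of_le_convex_step (b := fun _ => c) (ε := fun k => t k / c) hu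
    (.of_forall fun _ => ⟨hc.le, hc1⟩) ?_ (by simpa using ht.div_const c)
    (.of_forall fun k => ?_)
  · simpa using tendsto_natCast_atTop_atTop.atTop_mul_const hc
  · rw [mul_div_cancel₀ _ hc.ne']
    exact hrec k

/-- Combination of two coupled Lyapunov inequalities into a single one. -/
theorem exists_combined_lyapunov {c C D : ℝ} (hc : 0 < c) (hC : 0 < C) (hD : 0 < D) :
    ∃ α B : ℝ, 0 < α ∧ 0 < B ∧ ∀ V V' β β' r b e : ℝ, 0 ≤ β → 0 ≤ β' → 0 ≤ b → c ≤ 1 →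
      b ≤ c / 2 → 0 ≤ e →
      V' ≤ (1 - b) * V + D * (b * β + b * e + b ^ 2) - r ^ 2 / 2 →
      β' ≤ (1 - c) * β + C * r →
      V' + α * β' ^ 2 ≤ (1 - b) * (V + α * β ^ 2) + b * (B * (e + b)) := by
  -- Convexity of the square produces `C ^ 2 / c * r ^ 2`, and `α` scales this to exactly `r ^ 2 /
  -- 2`. Half of the gain `α * c * β ^ 2` absorbs `D * (b * β)` by Young's inequality, whose
  -- remainder is the second summand of `B`; the other half gives `α * b * β ^ 2`, as `b ≤ c / 2`.
  refine ⟨c / (2 * C ^ 2), D + D ^ 2 * C ^ 2 / c ^ 2, by positivity, by positivity, ?_⟩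
  intro V V' β β' r b e hβ hβ' hb hc1 hbc he hV hβr
  have h₁ : β' ^ 2 ≤ (1 - c) * β ^ 2 + C ^ 2 / c * r ^ 2 := by
    have hsq : β' ^ 2 ≤ ((1 - c) * β + C * r) ^ 2 := pow_le_pow_left₀ hβ' hβr 2
    have key : (1 - c) * β ^ 2 + C ^ 2 / c * r ^ 2 - ((1 - c) * β + C * r) ^ 2
        = (1 - c) / c * (c * β - C * r) ^ 2 := by
      field_simp
      ring
    have : 0 ≤ (1 - c) / c * (c * β - C * r) ^ 2 :=
      mul_nonneg (div_nonneg (by linarith) hc.le) (sq_nonneg _)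
    linarith
  have h₂ : c / (2 * C ^ 2) * β' ^ 2 ≤ c / (2 * C ^ 2) * ((1 - c) * β ^ 2) + r ^ 2 / 2 := by
    have := mul_le_mul_of_nonneg_left h₁ (by positivity : 0 ≤ c / (2 * C ^ 2))
    have e : c / (2 * C ^ 2) * (C ^ 2 / c * r ^ 2) = r ^ 2 / 2 := by field_simp
    linarith
  have h₃ : D * (b * β) ≤ c / (2 * C ^ 2) * (c / 2 * β ^ 2) + D ^ 2 * C ^ 2 / c ^ 2 * b ^ 2 := by
    have key : c / (2 * C ^ 2) * (c / 2 * β ^ 2) + D ^ 2 * C ^ 2 / c ^ 2 * b ^ 2 - D * (b * β)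
        = (c / (2 * C) * β - D * C / c * b) ^ 2 := by
      field_simp
      ring
    have := sq_nonneg (c / (2 * C) * β - D * C / c * b)
    linarith
  have h₄ : c / (2 * C ^ 2) * (b * β ^ 2) ≤ c / (2 * C ^ 2) * (c / 2 * β ^ 2) := by
    gcongr
  have h₅ : 0 ≤ D ^ 2 * C ^ 2 / c ^ 2 * (b * e) := by positivity
  nlinarith

end Recursion

/-! ### One-step descent of the fast iteration. -/

section FastStep

variable {N n : ℕ}

/-- Jensen along the rows, then unit column sums after exchanging the two summations. -/
theorem sum_norm_mix_sub_sq_le {Q : Matrix (Fin N) (Fin N) ℝ} (hQ : Q ∈ doublyStochastic ℝ (Fin N))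
    (z : Fin N → EuclideanSpace ℝ (Fin n)) (p : EuclideanSpace ℝ (Fin n)) :
    ∑ i, ‖mix Q z i - p‖ ^ 2 ≤ ∑ i, ‖z i - p‖ ^ 2 := by
  have hconv : ConvexOn ℝ Set.univ fun x : EuclideanSpace ℝ (Fin n) => ‖x‖ ^ 2 :=
    convexOn_univ_norm.pow (fun _ _ => norm_nonneg _) 2
  have h : ∀ i, ‖mix Q z i - p‖ ^ 2 ≤ ∑ j, Q i j * ‖z j - p‖ ^ 2 := fun i => by
    have e : mix Q z i - p = ∑ j, Q i j • (z j - p) := by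
      simp [mix, smul_sub, Finset.sum_sub_distrib, ← Finset.sum_smul,
        sum_row_of_mem_doublyStochastic hQ]
    rw [e]
    simpa using hconv.map_sum_le (t := Finset.univ) (w := Q i) (p := fun j => z j - p)
      (fun j _ => nonneg_of_mem_doublyStochastic hQ) (sum_row_of_mem_doublyStochastic hQ i)
      (fun _ _ => Set.mem_univ _)
  calc ∑ i, ‖mix Q z i - p‖ ^ 2 ≤ ∑ i, ∑ j, Q i j * ‖z j - p‖ ^ 2 :=
        Finset.sum_le_sum fun i _ => h i
    _ = ∑ i, ‖z i - p‖ ^ 2 := by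
      rw [Finset.sum_comm]
      simp [← Finset.sum_mul, sum_col_of_mem_doublyStochastic hQ]

/-- Descent of the squared distance to the target in one projected step at a single node. -/
theorem norm_proj_step_sub_sq_le {K : Set (EuclideanSpace ℝ (Fin n))} (hcv : Convex ℝ K)
    (hcl : IsClosed K) {p q v x y z : EuclideanSpace ℝ (Fin n)} (hp : p ∈ K) {b G d e o : ℝ}
    (hb : 0 ≤ b) (hG : 0 ≤ G) (hvy : ‖v - y‖ ≤ G) (hvp : ‖v - p‖ ≤ G) (hpx : ‖p - x‖ ≤ G)
    (hyx : ‖x - y‖ ≤ e) (hvq : ‖v - q‖ ≤ d) (hq : 0 ≤ inner ℝ (q - p) (p - x))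
    (hzv : ‖z - v‖ ≤ o) (ho : o ≤ G) :
    ‖proj K (v - b • (v - y)) - p‖ ^ 2 ≤ ‖v - p‖ ^ 2 - b * ‖z - p‖ ^ 2
      + 2 * b * (G * d + G * e + G * o) + 2 * b ^ 2 * G ^ 2
      - ‖proj K (v - b • (v - y)) - v‖ ^ 2 / 2 := by
  set u := v - b • (v - y) with hu
  set w := proj K u
  have h₁ : ‖w - p‖ ^ 2 ≤ ‖u - p‖ ^ 2 - ‖w - u‖ ^ 2 := norm_proj_sub_sq_le hcv hcl u hp
  have h₂ : ‖u - p‖ ^ 2 = ‖v - p‖ ^ 2 - 2 * b * inner ℝ (v - p) (v - y) + b ^ 2 * ‖v - y‖ ^ 2 := by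
    have e : u - p = (v - p) - b • (v - y) := by rw [hu]; abel
    rw [e, norm_sub_sq_real, inner_smul_right, norm_smul, Real.norm_of_nonneg hb]
    ring
  -- Split `v - y` at `p` and `x`, and `v - p` at `q`. The term with `q - p` has a good sign by the
  -- variational inequality; the other cross terms are small with `d` and `e`.
  have h₃ : inner ℝ (v - p) (v - y)
      = ‖v - p‖ ^ 2 + (inner ℝ (v - q) (p - x) + inner ℝ (q - p) (p - x))
        + inner ℝ (v - p) (x - y) := by
    rw [← real_inner_self_eq_norm_sq, ← inner_add_left, sub_add_sub_cancel, ← inner_add_right,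
      ← inner_add_right, sub_add_sub_cancel, sub_add_sub_cancel]
  have h₄ : -(G * d) ≤ inner ℝ (v - q) (p - x) := by
    have := (abs_le.1 (abs_real_inner_le_norm (v - q) (p - x))).1
    have := mul_le_mul hvq hpx (norm_nonneg _) ((norm_nonneg _).trans hvq)
    linarith
  have h₅ : -(G * e) ≤ inner ℝ (v - p) (x - y) := by
    have := (abs_le.1 (abs_real_inner_le_norm (v - p) (x - y))).1
    have := mul_le_mul hvp hyx (norm_nonneg _) hG
    linarith
  -- Passing from `v` to `z` in the gain term costs a factor two, but the summed estimate then needs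
  -- no upper bound on `b`.
  have h₆ : ‖z - p‖ ^ 2 ≤ 2 * ‖v - p‖ ^ 2 + 2 * (G * o) := by
    have ht : ‖z - p‖ ≤ ‖z - v‖ + ‖v - p‖ := norm_sub_le_norm_sub_add_norm_sub z v p
    have hs := pow_le_pow_left₀ (norm_nonneg _) ht 2
    have ho' : ‖z - v‖ ^ 2 ≤ G * o := by
      rw [sq]
      exact mul_le_mul (hzv.trans ho) hzv (norm_nonneg _) hG
    nlinarith [sq_nonneg (‖z - v‖ - ‖v - p‖)]
  have h₇ : ‖w - v‖ ^ 2 ≤ 2 * ‖w - u‖ ^ 2 + 2 * (b ^ 2 * G ^ 2) := by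
    have ht : ‖w - v‖ ≤ ‖w - u‖ + ‖u - v‖ := norm_sub_le_norm_sub_add_norm_sub w u v
    have hs := pow_le_pow_left₀ (norm_nonneg _) ht 2
    have huv : ‖u - v‖ ≤ b * G := by
      rw [hu, sub_sub_cancel_left, norm_neg, norm_smul, Real.norm_of_nonneg hb]
      exact mul_le_mul_of_nonneg_left hvy hb
    have := pow_le_pow_left₀ (norm_nonneg _) huv 2
    nlinarith [sq_nonneg (‖w - u‖ - ‖u - v‖)]
  have h₈ : b ^ 2 * ‖v - y‖ ^ 2 ≤ b ^ 2 * G ^ 2 := by gcongr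
  have h₉ : b * (‖z - p‖ ^ 2 - 2 * (G * o) - 2 * (G * d) - 2 * (G * e))
      ≤ b * (2 * inner ℝ (v - p) (v - y)) := mul_le_mul_of_nonneg_left (by linarith) hb
  linarith

/-- Descent of the squared distance to the target in one step of the distributed projected
gradient iteration. -/
theorem exists_fastStep_descent (hN : 0 < N) {X : Fin N → Set (EuclideanSpace ℝ (Fin n))}
    (hXconv : ∀ i, Convex ℝ (X i)) (hXcl : ∀ i, IsClosed (X i))
    (hXint : (interior (⋂ i, X i)).Nonempty)
    {Q : Matrix (Fin N) (Fin N) ℝ} (hQ : Q ∈ doublyStochastic ℝ (Fin N)) (R : ℝ) :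
    ∃ D : ℝ, 0 < D ∧ ∀ (z y : Fin N → EuclideanSpace ℝ (Fin n)) (x : EuclideanSpace ℝ (Fin n))
      (b e : ℝ), (∀ i, z i ∈ X i) → (∀ i, ‖z i‖ ≤ R) → (∀ i, ‖y i‖ ≤ R) → ‖x‖ ≤ R →
      ‖proj (⋂ i, X i) x‖ ≤ R → (∀ i, ‖x - y i‖ ≤ e) → 0 ≤ b →
      ∑ i, ‖fastStep X Q b z y i - proj (⋂ i, X i) x‖ ^ 2
        ≤ (1 - b) * ∑ i, ‖z i - proj (⋂ i, X i) x‖ ^ 2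
          + D * (b * osc z + b * e + b ^ 2) - ‖fastStep X Q b z y - mix Q z‖ ^ 2 / 2 := by
  obtain ⟨c, hc⟩ := hXint
  obtain ⟨ρ, hρ, hball⟩ := Metric.nhds_basis_closedBall.mem_iff.1 (mem_interior_iff_mem_nhds.1 hc)
  have hne : (⋂ i, X i).Nonempty := ⟨c, interior_subset hc⟩
  -- `G` bounds all distances that occur, including those to the ball's centre; `|R|` and `+ 1` make
  -- it positive for any `R`.
  let G : ℝ := 2 * (|R| + ‖c‖) + 1
  let D₀ : ℝ := 2 * G * (G / ρ + 1) + 2 * G + 2 * G ^ 2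
  have hG : 0 < G := by positivity
  have hND : 0 < (N : ℝ) * D₀ := mul_pos (by exact_mod_cast hN) (by positivity)
  refine ⟨N * D₀, hND, fun z y x b e hz hzR hyR hxR hpR hyx hb => ?_⟩
  set p := proj (⋂ i, X i) x with hp
  have hpX : p ∈ ⋂ i, X i := proj_mem hne (isClosed_iInter hXcl) x
  have hbd : ∀ s t : EuclideanSpace ℝ (Fin n), ‖s‖ ≤ R → ‖t‖ ≤ R → ‖s - t‖ ≤ G := by
    intro s t hs ht
    linarith [norm_sub_le s t, le_abs_self R, norm_nonneg c]
  have hrow := sum_row_of_mem_doublyStochastic hQ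
  have hnn : ∀ i j, 0 ≤ Q i j := fun i j => nonneg_of_mem_doublyStochastic hQ
  have hvR : ∀ i, ‖mix Q z i‖ ≤ R := fun i => by
    simpa using norm_mix_sub_le (hnn i) (hrow i) (c := 0) (r := R) (z := z) (by simpa using hzR)
  have hosc : osc z ≤ G := osc_le hG.le fun i j => hbd _ _ (hzR i) (hzR j)
  have hnode : ∀ i, ‖fastStep X Q b z y i - p‖ ^ 2 ≤ ‖mix Q z i - p‖ ^ 2 - b * ‖z i - p‖ ^ 2
      + D₀ * (b * osc z + b * e + b ^ 2) - ‖fastStep X Q b z y i - mix Q z i‖ ^ 2 / 2 := by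
    intro i
    obtain ⟨q, hq, hvq⟩ := exists_mem_iInter_norm_sub_le hXconv hρ hball (v := mix Q z i)
      (osc_nonneg z) fun j => ⟨z j, hz j, norm_mix_sub_le (hnn i) (hrow i)
        fun l => norm_sub_le_osc z l j⟩
    have hvc : ‖mix Q z i - c‖ ≤ G := by
      linarith [norm_sub_le (mix Q z i) c, hvR i, le_abs_self R, norm_nonneg c, abs_nonneg R]
    have hvq' : ‖mix Q z i - q‖ ≤ osc z / ρ * G :=
      hvq.trans (mul_le_mul_of_nonneg_left hvc (div_nonneg (osc_nonneg z) hρ.le))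
    have hqp : 0 ≤ inner ℝ (q - p) (p - x) := by
      have := inner_sub_proj_le_zero (convex_iInter hXconv) (isClosed_iInter hXcl) x hq
      rw [← hp, real_inner_comm, ← neg_sub p x, inner_neg_right] at this
      linarith
    have hzv : ‖z i - mix Q z i‖ ≤ osc z := by
      rw [norm_sub_rev]
      exact norm_mix_sub_le (hnn i) (hrow i) fun l => norm_sub_le_osc z l i
    have := norm_proj_step_sub_sq_le (hXconv i) (hXcl i) (Set.mem_iInter.1 hpX i) hb hG.le
      (hbd _ _ (hvR i) (hyR i)) (hbd _ _ (hvR i) hpR) (hbd _ _ hpR hxR) (hyx i) hvq' hqp hzv hosc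
    have he : 0 ≤ e := (norm_nonneg _).trans (hyx i)
    have ho := osc_nonneg z
    have e₁ : 2 * b * (G * (osc z / ρ * G) + G * e + G * osc z) + 2 * b ^ 2 * G ^ 2
        = 2 * G * (G / ρ + 1) * (b * osc z) + 2 * G * (b * e) + 2 * G ^ 2 * b ^ 2 := by
      ring
    have e₂ : 2 * G * (G / ρ + 1) * (b * osc z) ≤ D₀ * (b * osc z) :=
      mul_le_mul_of_nonneg_right (by simp only [D₀]; nlinarith) (by positivity)
    have hGρ : 0 ≤ 2 * G * (G / ρ + 1) := by positivity
    have e₃ : 2 * G * (b * e) ≤ D₀ * (b * e) :=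
      mul_le_mul_of_nonneg_right (by simp only [D₀]; nlinarith) (by positivity)
    have e₄ : 2 * G ^ 2 * b ^ 2 ≤ D₀ * b ^ 2 :=
      mul_le_mul_of_nonneg_right (by simp only [D₀]; nlinarith) (by positivity)
    change ‖fastStep X Q b z y i - p‖ ^ 2 ≤ _ - ‖fastStep X Q b z y i - mix Q z i‖ ^ 2 / 2 at this
    linarith
  -- Stacked vectors carry the sup norm, so the largest node term suffices.
  have hr : ‖fastStep X Q b z y - mix Q z‖ ^ 2 ≤ ∑ i, ‖fastStep X Q b z y i - mix Q z i‖ ^ 2 := by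
    have : Nonempty (Fin N) := ⟨⟨0, hN⟩⟩
    obtain ⟨i, hi⟩ := Finite.exists_max fun i => ‖(fastStep X Q b z y - mix Q z) i‖
    have hle : ‖fastStep X Q b z y - mix Q z‖ ≤ ‖fastStep X Q b z y i - mix Q z i‖ :=
      (pi_norm_le_iff_of_nonneg (norm_nonneg _)).2 hi
    exact (pow_le_pow_left₀ (norm_nonneg _) hle 2).trans
      (Finset.single_le_sum (f := fun i => ‖fastStep X Q b z y i - mix Q z i‖ ^ 2)
        (fun _ _ => by positivity) (Finset.mem_univ i))
  have hsum := Finset.sum_le_sum fun i (_ : i ∈ Finset.univ) => hnode i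
  simp only [Finset.sum_add_distrib, Finset.sum_sub_distrib, ← Finset.mul_sum, ← Finset.sum_div,
    Finset.sum_const, Finset.card_univ, Fintype.card_fin, nsmul_eq_mul] at hsum
  linarith [sum_norm_mix_sub_sq_le hQ z p]

end FastStep

/-! ### Tracking a slow target, and consensus of the slow iterates. -/

section Tracking

variable {N n : ℕ}

/-- The distributed projected gradient iteration tracks the projection of a target that moves
slowly compared with the step sizes. -/
theorem tendsto_norm_sub_proj_of_slow_target (hN : 0 < N)
    {X : Fin N → Set (EuclideanSpace ℝ (Fin n))}
    (hXconv : ∀ i, Convex ℝ (X i)) (hXcomp : ∀ i, IsCompact (X i))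
    (hXint : (interior (⋂ i, X i)).Nonempty)
    {Q : Matrix (Fin N) (Fin N) ℝ} (hQ : Q ∈ doublyStochastic ℝ (Fin N)) (hprim : Q.IsPrimitive)
    {b : ℕ → ℝ} (hb : ∀ k, 0 < b k) (hb0 : Tendsto b atTop (𝓝 0))
    (hbsum : Tendsto (fun m => ∑ k ∈ Finset.range m, b k) atTop atTop)
    {z y : ℕ → Fin N → EuclideanSpace ℝ (Fin n)} {x : ℕ → EuclideanSpace ℝ (Fin n)}
    (hz : ∀ k, z (k + 1) = fastStep X Q (b k) (z k) (y k))
    {C : ℝ} (hx : ∀ᶠ k in atTop, ‖x k‖ ≤ C)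
    (hxy : ∀ i, Tendsto (fun k => x k - y k i) atTop (𝓝 0))
    (hdx : (fun k => x (k + 1) - x k) =o[atTop] b) (i : Fin N) :
    Tendsto (fun k => ‖z k i - proj (⋂ j, X j) (x k)‖) atTop (𝓝 0) := by
  have hXcl : ∀ i, IsClosed (X i) := fun i => (hXcomp i).isClosed
  have hne : (⋂ i, X i).Nonempty := hXint.mono interior_subset
  let p : ℕ → EuclideanSpace ℝ (Fin n) := fun k => proj (⋂ j, X j) (x k)
  have hpX : ∀ k j, p k ∈ X j := fun k =>
    Set.mem_iInter.1 (proj_mem hne (isClosed_iInter hXcl) (x k))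
  have hXne : ∀ j, (X j).Nonempty := fun j => ⟨p 0, hpX 0 j⟩
  -- The initial point is arbitrary; feasibility starts with the first projection.
  have hzX : ∀ k, 1 ≤ k → ∀ j, z k j ∈ X j := by
    intro k hk j
    obtain ⟨k, rfl⟩ := Nat.exists_eq_add_of_le' hk
    rw [hz]
    exact proj_mem (hXne j) (hXcl j) _
  obtain ⟨R₀, hR₀⟩ := (isCompact_iUnion hXcomp).isBounded.exists_norm_le
  have hXR : ∀ j, ∀ q ∈ X j, ‖q‖ ≤ R₀ := fun j q hq => hR₀ q (Set.mem_iUnion_of_mem j hq)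
  let R : ℝ := max R₀ (C + 1)
  let e : ℕ → ℝ := fun k => ‖fun j => x k - y k j‖
  have he0 : Tendsto e atTop (𝓝 0) := tendsto_zero_iff_norm_tendsto_zero.1 (tendsto_pi_nhds.2 hxy)
  have hyx : ∀ k j, ‖x k - y k j‖ ≤ e k := fun k => norm_le_pi_norm (fun j => x k - y k j)
  -- Speed of the target relative to the step size; the projected target is no faster, as
  -- projections are nonexpansive.
  let δ : ℕ → ℝ := fun k => ‖x (k + 1) - x k‖ / b k
  have hδ0 : Tendsto δ atTop (𝓝 0) := hdx.norm_left.tendsto_div_nhds_zero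
  have hδ : ∀ k, ‖p (k + 1) - p k‖ ≤ b k * δ k := fun k => by
    rw [mul_div_cancel₀ _ (hb k).ne']
    exact norm_proj_sub_proj_le hne (convex_iInter hXconv) (isClosed_iInter hXcl) _ _
  obtain ⟨D, hD, hdesc⟩ := exists_fastStep_descent hN hXconv hXcl hXint hQ R
  obtain ⟨β, c, C₂, hc, hc1, hC₂, hoscβ, hβ⟩ := exists_consensus_lyapunov (n := n) hN hQ hprim
  have hβ0 : ∀ u, 0 ≤ β u := fun u => (osc_nonneg u).trans (hoscβ u)
  obtain ⟨α, B, hα, hB, hcomb⟩ := exists_combined_lyapunov hc hC₂ hD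
  let U : ℕ → ℝ := fun k => ∑ j, ‖z k j - p k‖ ^ 2 + α * β (z k) ^ 2
  have hU : ∀ k, 0 ≤ U k := fun k => by positivity
  -- Difference of squares: both distances are at most `2 * R₀`, hence the factor `4 * R₀`.
  have hmove : ∀ k, ∑ j, ‖z (k + 1) j - p (k + 1)‖ ^ 2
      ≤ ∑ j, ‖z (k + 1) j - p k‖ ^ 2 + b k * (N * (4 * R₀ * δ k)) := by
    intro k
    have hj : ∀ j, ‖z (k + 1) j - p (k + 1)‖ ^ 2
        ≤ ‖z (k + 1) j - p k‖ ^ 2 + 4 * R₀ * (b k * δ k) := by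
      intro j
      have hzR := hXR j _ (hzX (k + 1) (by omega) j)
      have h₁ : ‖z (k + 1) j - p (k + 1)‖ ≤ 2 * R₀ := by
        linarith [norm_sub_le (z (k + 1) j) (p (k + 1)), hXR j _ (hpX (k + 1) j)]
      have h₂ : ‖z (k + 1) j - p k‖ ≤ 2 * R₀ := by
        linarith [norm_sub_le (z (k + 1) j) (p k), hXR j _ (hpX k j)]
      have h₃ : ‖z (k + 1) j - p (k + 1)‖ - ‖z (k + 1) j - p k‖ ≤ b k * δ k := by
        have := norm_sub_le_norm_sub_add_norm_sub (z (k + 1) j) (p k) (p (k + 1))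
        rw [norm_sub_rev (p k)] at this
        linarith [hδ k]
      have h₄ : 0 ≤ b k * δ k := (norm_nonneg _).trans (hδ k)
      nlinarith [norm_nonneg (z (k + 1) j - p (k + 1)), norm_nonneg (z (k + 1) j - p k)]
    refine (Finset.sum_le_sum fun j _ => hj j).trans_eq ?_
    rw [Finset.sum_add_distrib]
    simp only [Finset.sum_const, Finset.card_univ, Fintype.card_fin, nsmul_eq_mul]
    ring
  have hU0 : Tendsto U atTop (𝓝 0) := by
    refine tendsto_zero_of_le_convex_step (b := b)
      (ε := fun k => B * (e k + b k) + N * (4 * R₀ * δ k)) hU ?_ hbsum ?_ ?_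
    · filter_upwards [hb0.eventually_le_const one_pos] with k hk using ⟨(hb k).le, hk⟩
    · have := ((he0.add hb0).const_mul B).add ((hδ0.const_mul (4 * R₀)).const_mul (N : ℝ))
      simpa using this
    · filter_upwards [hx, he0.eventually_le_const one_pos, eventually_ge_atTop 1,
        hb0.eventually_le_const (half_pos hc)] with k hxk hek hk hbk
      have hyR : ∀ j, ‖y k j‖ ≤ R := fun j => by
        have := norm_sub_norm_le (y k j) (x k)
        rw [norm_sub_rev] at this
        exact le_max_of_le_right (by linarith [hyx k j])
      have h₁ := hdesc (z k) (y k) (x k) (b k) (e k) (hzX k hk)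
        (fun j => le_max_of_le_left (hXR j _ (hzX k hk j))) hyR
        (le_max_of_le_right (by linarith)) (le_max_of_le_left (hXR ⟨0, hN⟩ _ (hpX k _)))
        (hyx k) (hb k).le
      have h₂ := hβ (z k) (z (k + 1) - mix Q (z k))
      rw [add_sub_cancel] at h₂
      rw [← hz] at h₁
      have h₃ := hcomb _ _ (β (z k)) (β (z (k + 1))) _ (b k) (e k) (hβ0 _) (hβ0 _) (hb k).le hc1
        hbk (norm_nonneg _) (h₁.trans (by
          have := mul_le_mul_of_nonneg_left (hoscβ (z k)) (hb k).le
          gcongr)) h₂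
      have := hmove k
      simp only [U]
      linarith
  have hsq : Tendsto (fun k => ‖z k i - p k‖ ^ 2) atTop (𝓝 0) := by
    refine squeeze_zero (fun k => by positivity) (fun k => ?_) hU0
    have := Finset.single_le_sum (f := fun j => ‖z k j - p k‖ ^ 2) (fun _ _ => by positivity)
      (Finset.mem_univ i)
    have h' : 0 ≤ α * β (z k) ^ 2 := by positivity
    simp only [U]
    linarith
  simpa [Real.sqrt_sq (norm_nonneg _)] using hsq.sqrt

theorem nodeAvg_add (u v : Fin N → EuclideanSpace ℝ (Fin n)) :
    nodeAvg (u + v) = nodeAvg u + nodeAvg v := by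
  simp [nodeAvg, Finset.sum_add_distrib]

theorem nodeAvg_smul (t : ℝ) (u : Fin N → EuclideanSpace ℝ (Fin n)) :
    nodeAvg (t • u) = t • nodeAvg u := by
  simp only [nodeAvg, Pi.smul_apply, ← Finset.smul_sum]
  exact smul_comm _ _ _

theorem nodeAvg_mix {Q : Matrix (Fin N) (Fin N) ℝ} (hQ : Q ∈ doublyStochastic ℝ (Fin N))
    (u : Fin N → EuclideanSpace ℝ (Fin n)) : nodeAvg (mix Q u) = nodeAvg u := by
  simp only [nodeAvg, mix]
  rw [Finset.sum_comm]
  simp [← Finset.sum_smul, sum_col_of_mem_doublyStochastic hQ]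

theorem norm_nodeAvg_sub_le (hN : 0 < N) {u : Fin N → EuclideanSpace ℝ (Fin n)}
    {c : EuclideanSpace ℝ (Fin n)} {r : ℝ} (h : ∀ j, ‖u j - c‖ ≤ r) : ‖nodeAvg u - c‖ ≤ r := by
  have hN' : (N : ℝ) ≠ 0 := by exact_mod_cast hN.ne'
  have := norm_mix_sub_le (A := fun _ _ => (N : ℝ)⁻¹) (i := ⟨0, hN⟩) (fun _ => by positivity)
    (by simp [hN']) h
  simpa [mix, ← Finset.smul_sum, nodeAvg] using this

theorem norm_nodeAvg_le (hN : 0 < N) {u : Fin N → EuclideanSpace ℝ (Fin n)} {r : ℝ}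
    (h : ∀ j, ‖u j‖ ≤ r) : ‖nodeAvg u‖ ≤ r := by
  simpa using norm_nodeAvg_sub_le hN (c := 0) (by simpa using h)

/-- Consensus of a mixing iteration with a vanishing perturbation. -/
theorem tendsto_nodeAvg_sub (hN : 0 < N) {Q : Matrix (Fin N) (Fin N) ℝ}
    (hQ : Q ∈ doublyStochastic ℝ (Fin N)) (hprim : Q.IsPrimitive)
    {y r : ℕ → Fin N → EuclideanSpace ℝ (Fin n)} (hy : ∀ k, y (k + 1) = mix Q (y k) + r k)
    (hr : Tendsto r atTop (𝓝 0)) (i : Fin N) :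
    Tendsto (fun k => nodeAvg (y k) - y k i) atTop (𝓝 0) := by
  obtain ⟨β, c, C, hc, hc1, hC, hoscβ, hβ⟩ := exists_consensus_lyapunov (n := n) hN hQ hprim
  have h0 : Tendsto (fun k => β (y k)) atTop (𝓝 0) := by
    refine tendsto_zero_of_le_contraction (t := fun k => C * ‖r k‖) hc hc1
      (fun k => (osc_nonneg _).trans (hoscβ _)) ?_ fun k => by rw [hy]; exact hβ _ _
    simpa using hr.norm.const_mul C
  exact squeeze_zero_norm (fun k => (norm_nodeAvg_sub_le hN fun j =>
    norm_sub_le_osc (y k) j i).trans (hoscβ _)) h0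

/-- Two-time-scale tracking along a path on which the weighted noise is summable. -/
theorem tendsto_norm_sub_proj_nodeAvg (hN : 0 < N)
    {X : Fin N → Set (EuclideanSpace ℝ (Fin n))}
    (hXconv : ∀ i, Convex ℝ (X i)) (hXcomp : ∀ i, IsCompact (X i))
    (hXint : (interior (⋂ i, X i)).Nonempty)
    {Q : Matrix (Fin N) (Fin N) ℝ} (hQ : Q ∈ doublyStochastic ℝ (Fin N)) (hprim : Q.IsPrimitive)
    {h : Fin N → EuclideanSpace ℝ (Fin n) → EuclideanSpace ℝ (Fin n)} (hh : ∀ i, Continuous (h i))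
    {a b : ℕ → ℝ} (hb : ∀ k, 0 < b k) (hb0 : Tendsto b atTop (𝓝 0)) (ha0 : Tendsto a atTop (𝓝 0))
    (hab : a =o[atTop] b) (hbsum : Tendsto (fun m => ∑ k ∈ Finset.range m, b k) atTop atTop)
    {z y m : ℕ → Fin N → EuclideanSpace ℝ (Fin n)}
    (hz : ∀ k, z (k + 1) = fastStep X Q (b k) (z k) (y k))
    (hy : ∀ k, y (k + 1) = slowStep Q h (a k) (z k) (y k) (m (k + 1)))
    {C : ℝ} (hC : ∀ k i, ‖y k i‖ ≤ C)
    (hm : ∃ l, Tendsto (fun k => ∑ j ∈ Finset.range k, a j • m (j + 1)) atTop (𝓝 l))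
    (i : Fin N) :
    Tendsto (fun k => ‖z k i - proj (⋂ j, X j) (nodeAvg (y k))‖) atTop (𝓝 0) := by
  have hXcl : ∀ i, IsClosed (X i) := fun i => (hXcomp i).isClosed
  have hne : (⋂ i, X i).Nonempty := hXint.mono interior_subset
  obtain ⟨l, hl⟩ := hm
  let g : ℕ → Fin N → EuclideanSpace ℝ (Fin n) := fun k i => z k i - y k i + h i (y k i)
  have hstep : ∀ k, y (k + 1) = mix Q (y k) + (a k • g k + a k • m (k + 1)) := fun k => by
    rw [hy]
    ext1 j
    simp only [slowStep, Pi.add_apply, Pi.smul_apply, g, smul_add]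
    abel
  obtain ⟨G, hG⟩ : ∃ G, ∀ᶠ k in atTop, ∀ j, ‖g k j‖ ≤ G := by
    obtain ⟨R, hR⟩ := (isCompact_iUnion hXcomp).isBounded.exists_norm_le
    obtain ⟨H, hH⟩ := (isCompact_iUnion fun j =>
      (isCompact_closedBall (0 : EuclideanSpace ℝ (Fin n)) C).image (hh j)).isBounded.exists_norm_le
    refine ⟨R + C + H, ?_⟩
    filter_upwards [eventually_ge_atTop 1] with k hk j
    obtain ⟨k, rfl⟩ := Nat.exists_eq_add_of_le' hk
    have hzj : ‖z (k + 1) j‖ ≤ R := by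
      refine hR _ (Set.mem_iUnion_of_mem j ?_)
      rw [hz]
      exact proj_mem (hne.mono (Set.iInter_subset _ j)) (hXcl j) _
    have hhj : ‖h j (y (k + 1) j)‖ ≤ H := hH _ (Set.mem_iUnion_of_mem j
      ⟨y (k + 1) j, by simpa using hC (k + 1) j, rfl⟩)
    have h₁ := norm_add_le (z (k + 1) j - y (k + 1) j) (h j (y (k + 1) j))
    have h₂ := norm_sub_le (z (k + 1) j) (y (k + 1) j)
    simp only [g]
    linarith [hC (k + 1) j]
  have hag : (fun k => nodeAvg (a k • g k)) =O[atTop] a := by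
    refine Asymptotics.IsBigO.of_bound G ?_
    filter_upwards [hG] with k hk
    rw [nodeAvg_smul, norm_smul, mul_comm]
    exact mul_le_mul_of_nonneg_right (norm_nodeAvg_le hN hk) (norm_nonneg _)
  have hr : Tendsto (fun k => a k • g k + a k • m (k + 1)) atTop (𝓝 0) := by
    rw [← add_zero (0 : Fin N → EuclideanSpace ℝ (Fin n))]
    refine Tendsto.add ?_ ?_
    · refine squeeze_zero_norm' (a := fun k => ‖a k‖ * |G|) ?_ (by simpa using ha0.norm.mul_const |G|)
      filter_upwards [hG] with k hk
      rw [norm_smul]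
      refine mul_le_mul_of_nonneg_left ?_ (norm_nonneg _)
      exact (pi_norm_le_iff_of_nonneg (abs_nonneg G)).2 fun j => (hk j).trans (le_abs_self G)
    -- The weighted noise terms are increments of convergent partial sums.
    · have := (hl.comp (tendsto_add_atTop_nat 1)).sub hl
      simpa [Finset.sum_range_succ] using this
  have hcons := tendsto_nodeAvg_sub hN hQ hprim hstep hr
  let ξ : ℕ → EuclideanSpace ℝ (Fin n) := fun k =>
    nodeAvg (∑ j ∈ Finset.range k, a j • m (j + 1)) - nodeAvg l
  have hξ : Tendsto ξ atTop (𝓝 0) := by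
    have hcont : Continuous (nodeAvg : (Fin N → EuclideanSpace ℝ (Fin n)) → _) := by
      unfold nodeAvg
      fun_prop
    simpa using ((hcont.tendsto l).comp hl).sub_const (nodeAvg l)
  -- Since `ξ` has exactly the averaged noise as its increments, `x` moves by the averaged drift
  -- alone, while `ξ → 0` keeps it asymptotic to `⟨y k⟩`.
  let x : ℕ → EuclideanSpace ℝ (Fin n) := fun k => nodeAvg (y k) - ξ k
  have hdx : ∀ k, x (k + 1) - x k = nodeAvg (a k • g k) := fun k => by
    simp only [x, ξ, Finset.sum_range_succ, nodeAvg_add, hstep k, nodeAvg_mix hQ]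
    abel
  have htrack := tendsto_norm_sub_proj_of_slow_target (x := x) (C := C + 1) hN hXconv hXcomp hXint
    hQ hprim hb hb0 hbsum hz ?_ (fun j => ?_) ?_ i
  · have hsum := htrack.add hξ.norm
    rw [norm_zero, add_zero] at hsum
    refine squeeze_zero (fun _ => norm_nonneg _) (fun k => ?_) hsum
    have h₁ := norm_sub_le_norm_sub_add_norm_sub (z k i) (proj (⋂ j, X j) (x k))
      (proj (⋂ j, X j) (nodeAvg (y k)))
    have h₂ := norm_proj_sub_proj_le hne (convex_iInter hXconv) (isClosed_iInter hXcl) (x k)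
      (nodeAvg (y k))
    have e : x k - nodeAvg (y k) = -ξ k := by simp [x]
    rw [e, norm_neg] at h₂
    linarith
  · filter_upwards [hξ.norm.eventually_le_const (u := 1) (by simp)] with k hk
    have := norm_sub_le (nodeAvg (y k)) (ξ k)
    have := norm_nodeAvg_le hN (hC k)
    simp only [x]
    linarith
  · have := (hcons j).sub hξ
    rw [sub_zero] at this
    refine this.congr fun k => ?_
    simp only [x]
    abel
  · simp only [hdx]
    exact hag.trans_isLittleO hab

end Tracking

/-! ### Almost sure convergence of the weighted noise. -/

section Noise

variable {Ω : Type*} {m0 : MeasurableSpace Ω} {μ : Measure Ω} [IsProbabilityMeasure μ]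

/-- Square-summable martingale differences are almost surely summable. -/
theorem ae_exists_tendsto_sum_of_condExp_eq_zero (ℱ : Filtration ℕ m0) {d : ℕ → Ω → ℝ}
    (hmeas : ∀ k, StronglyMeasurable[ℱ (k + 1)] (d k)) (hL2 : ∀ k, MemLp (d k) 2 μ)
    (hd : ∀ k, μ[d k | ℱ k] =ᵐ[μ] 0) {v : ℕ → ℝ} (hv : ∀ k, ∫ ω, d k ω ^ 2 ∂μ ≤ v k)
    (hsum : Summable v) :
    ∀ᵐ ω ∂μ, ∃ c, Tendsto (fun m => ∑ k ∈ Finset.range m, d k ω) atTop (𝓝 c) := by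
  let S : ℕ → Ω → ℝ := fun m ω => ∑ k ∈ Finset.range m, d k ω
  have hSsucc : ∀ m, S (m + 1) = S m + d m := fun m => by
    ext1 ω
    simp [S, Finset.sum_range_succ]
  have hSmeas : ∀ m, StronglyMeasurable[ℱ m] (S m) := fun m =>
    Finset.stronglyMeasurable_fun_sum _ fun k hk =>
      (hmeas k).mono (ℱ.mono (Finset.mem_range.1 hk))
  have hSL2 : ∀ m, MemLp (S m) 2 μ := fun m => memLp_finsetSum _ fun k _ => hL2 k
  have hSint : ∀ m, Integrable (S m) μ := fun m => (hSL2 m).integrable one_le_two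
  have hdint : ∀ m, Integrable (d m) μ := fun m => (hL2 m).integrable one_le_two
  -- Orthogonality of martingale differences: second moments of the increments add up, so `S` is
  -- bounded in `L²`.
  have horth : ∀ m, ∫ ω, S m ω * d m ω ∂μ = 0 := fun m => by
    have h := condExp_mul_of_stronglyMeasurable_left (hSmeas m)
      ((hSL2 m).integrable_mul (hL2 m)) (hdint m)
    have h0 : μ[S m * d m | ℱ m] =ᵐ[μ] 0 := by
      filter_upwards [h, hd m] with ω h₁ h₂
      simp [h₁, h₂]
    have := integral_condExp (ℱ.le m) (μ := μ) (f := S m * d m)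
    rw [integral_congr_ae h0] at this
    simpa using this.symm
  have hSq : ∀ m, ∫ ω, S m ω ^ 2 ∂μ ≤ ∑ k ∈ Finset.range m, v k := fun m => by
    induction m with
    | zero => simp [S]
    | succ m ih =>
      have e : ∀ ω, S (m + 1) ω ^ 2 = S m ω ^ 2 + 2 * (S m ω * d m ω) + d m ω ^ 2 := fun ω => by
        rw [hSsucc, Pi.add_apply]
        ring
      have i₁ := (hSL2 m).integrable_sq
      have i₃ := (hL2 m).integrable_sq
      have i₂ : Integrable (fun ω => 2 * (S m ω * d m ω)) μ :=
        ((hSL2 m).integrable_mul (hL2 m)).const_mul 2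
      simp_rw [e]
      rw [integral_add (by exact i₁.add i₂) i₃, integral_add i₁ i₂, integral_const_mul, horth,
        Finset.sum_range_succ]
      linarith [hv m]
  have hvnn : ∀ k, 0 ≤ v k := fun k => (integral_nonneg fun ω => sq_nonneg _).trans (hv k)
  have hmart : Submartingale S ℱ μ := by
    refine submartingale_of_condExp_sub_nonneg_nat hSmeas hSint fun m => ?_
    rw [hSsucc, add_sub_cancel_left]
    exact (hd m).symm.le
  refine hmart.exists_ae_tendsto_of_bdd (R := (∑' k, v k + 1).toNNReal) fun m => ?_
  rw [eLpNorm_one_eq_lintegral_enorm, ← ofReal_integral_norm_eq_lintegral_enorm (hSint m)]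
  refine ENNReal.ofReal_le_ofReal ?_
  -- The convergence theorem asks for an `L¹` bound, which `|s| ≤ s² + 1` provides.
  calc ∫ ω, ‖S m ω‖ ∂μ ≤ ∫ ω, (S m ω ^ 2 + 1) ∂μ := by
        refine integral_mono (hSint m).norm ((hSL2 m).integrable_sq.add (integrable_const 1))
          fun ω => ?_
        rw [Real.norm_eq_abs]
        nlinarith [sq_abs (S m ω), sq_nonneg (|S m ω| - 1)]
    _ = ∫ ω, S m ω ^ 2 ∂μ + 1 := by
        rw [integral_add (hSL2 m).integrable_sq (integrable_const 1)]
        simp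
    _ ≤ ∑' k, v k + 1 := by
        linarith [hSq m, hsum.sum_le_tsum (Finset.range m) fun k _ => hvnn k]

variable {n : ℕ}

/-- Weighted martingale-difference noise with conditional second moments controlled by an almost
surely bounded adapted process is almost surely summable. -/
theorem ae_exists_tendsto_sum_smul_noise (ℱ : Filtration ℕ m0)
    {Y W : ℕ → Ω → EuclideanSpace ℝ (Fin n)} {a : ℕ → ℝ} {K : ℝ} (hK : 0 ≤ K)
    (ha : Summable fun k => a k ^ 2)
    (hY : ∀ k, StronglyMeasurable[ℱ k] (Y k)) (hW : ∀ k, StronglyMeasurable[ℱ (k + 1)] (W k))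
    (hWint : ∀ k, Integrable (W k) μ) (hWmds : ∀ k, μ[W k | ℱ k] =ᵐ[μ] 0)
    (hWvar : ∀ k, ∀ᵐ ω ∂μ, condLExp (ℱ k) μ (fun ω' => ‖W k ω'‖ₑ ^ 2) ω
      ≤ ENNReal.ofReal (K * (1 + ‖Y k ω‖ ^ 2)))
    (hbdd : ∀ᵐ ω ∂μ, ∃ C : ℝ, ∀ k, ‖Y k ω‖ ≤ C) :
    ∀ᵐ ω ∂μ, ∃ l, Tendsto (fun m => ∑ k ∈ Finset.range m, a k • W k ω) atTop (𝓝 l) := by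
  -- Truncation: the event is known at time `k`, so cutting `W k` off outside it preserves the
  -- martingale-difference property and bounds the second moment by `K * (1 + C ^ 2)`. On a path
  -- bounded by `C` nothing is cut off.
  let A : ℕ → ℕ → Set Ω := fun C k => {ω | ‖Y k ω‖ ≤ C}
  have hA : ∀ C k, MeasurableSet[ℱ k] (A C k) := fun C k =>
    measurableSet_le (hY k).norm.measurable measurable_const
  have key : ∀ (C : ℕ) (i : Fin n), ∀ᵐ ω ∂μ, ∃ c, Tendsto
      (fun m => ∑ k ∈ Finset.range m, a k * (A C k).indicator (fun ω => W k ω i) ω)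
      atTop (𝓝 c) := by
    intro C i
    let T : EuclideanSpace ℝ (Fin n) →L[ℝ] ℝ := EuclideanSpace.proj i
    let w : ℕ → Ω → ℝ := fun k => (A C k).indicator fun ω => W k ω i
    have hWi : ∀ k, Integrable (fun ω => W k ω i) μ := fun k =>
      T.integrable_comp (hWint k)
    have hWimeas : ∀ k, StronglyMeasurable[ℱ (k + 1)] fun ω => W k ω i := fun k =>
      T.continuous.comp_stronglyMeasurable (hW k)
    have hwmeas : ∀ k, StronglyMeasurable[ℱ (k + 1)] (w k) := fun k =>
      (hWimeas k).indicator (ℱ.mono (Nat.le_succ k) _ (hA C k))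
    -- Lower integrals are used because `W k` is only assumed integrable; square integrability of `w
    -- k` is a consequence of this bound.
    have hlint : ∀ k, ∫⁻ ω, ENNReal.ofReal (w k ω ^ 2) ∂μ ≤ ENNReal.ofReal (K * (1 + C ^ 2)) := by
      intro k
      have hAm := ℱ.le k _ (hA C k)
      calc ∫⁻ ω, ENNReal.ofReal (w k ω ^ 2) ∂μ
          ≤ ∫⁻ ω, (A C k).indicator (fun ω => ‖W k ω‖ₑ ^ 2) ω ∂μ := by
            refine lintegral_mono fun ω => ?_
            by_cases hω : ω ∈ A C k
            · simp only [w, Set.indicator_of_mem hω]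
              rw [← ofReal_norm, ← ENNReal.ofReal_pow (norm_nonneg _)]
              refine ENNReal.ofReal_le_ofReal ?_
              rw [← sq_abs]
              exact pow_le_pow_left₀ (abs_nonneg _) (PiLp.norm_apply_le (W k ω) i) 2
            · simp [w, hω]
        _ = ∫⁻ ω in A C k, condLExp (ℱ k) μ (fun ω' => ‖W k ω'‖ₑ ^ 2) ω ∂μ := by
            rw [lintegral_indicator hAm, setLIntegral_condLExp (ℱ.le k) μ _ (hA C k)]
        _ ≤ ∫⁻ ω in A C k, ENNReal.ofReal (K * (1 + C ^ 2)) ∂μ := by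
            refine setLIntegral_mono_ae' hAm ?_
            filter_upwards [hWvar k] with ω hω hωA
            refine hω.trans (ENNReal.ofReal_le_ofReal ?_)
            have : ‖Y k ω‖ ≤ C := hωA
            gcongr
        _ ≤ ENNReal.ofReal (K * (1 + C ^ 2)) := by
            rw [setLIntegral_const]
            exact mul_le_of_le_one_right' prob_le_one
    have hwm : ∀ k, AEStronglyMeasurable (w k) μ := fun k =>
      ((hwmeas k).mono (ℱ.le _)).aestronglyMeasurable
    have hwL2 : ∀ k, MemLp (w k) 2 μ := fun k => by
      rw [memLp_two_iff_integrable_sq (hwm k)]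
      refine ⟨(hwm k).pow 2, ?_⟩
      rw [hasFiniteIntegral_iff_ofReal (.of_forall fun ω => sq_nonneg _)]
      exact (hlint k).trans_lt ENNReal.ofReal_lt_top
    have hwsq : ∀ k, ∫ ω, w k ω ^ 2 ∂μ ≤ K * (1 + C ^ 2) := fun k => by
      rw [integral_eq_lintegral_of_nonneg_ae (.of_forall fun ω => sq_nonneg _) ((hwm k).pow 2)]
      exact ENNReal.toReal_le_of_le_ofReal (by positivity) (hlint k)
    have hwmds : ∀ k, μ[w k | ℱ k] =ᵐ[μ] 0 := fun k => by
      have h₁ := condExp_indicator (m := ℱ k) (hWi k) (hA C k)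
      have h₂ := T.comp_condExp_comm (m := ℱ k) (hWint k)
      filter_upwards [h₁, h₂, hWmds k] with ω e₁ e₂ e₃
      have e₄ : μ[fun ω => W k ω i | ℱ k] ω = 0 := by
        rw [Function.comp_apply, e₃, Pi.zero_apply, map_zero] at e₂
        exact e₂.symm
      rw [e₁]
      simp [Set.indicator_apply, e₄]
    refine ae_exists_tendsto_sum_of_condExp_eq_zero ℱ (d := fun k ω => a k * w k ω)
      (fun k => (hwmeas k).const_mul _) (fun k => (hwL2 k).const_mul _) (fun k => ?_)
      (v := fun k => a k ^ 2 * (K * (1 + C ^ 2))) (fun k => ?_) (ha.mul_right _)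
    · have := condExp_smul (μ := μ) (a k) (w k) (ℱ k)
      filter_upwards [this, hwmds k] with ω e₁ e₂
      have e₃ : μ[fun ω => a k * w k ω | ℱ k] ω = a k * μ[w k | ℱ k] ω := e₁
      rw [e₃, e₂]
      simp
    · simp_rw [mul_pow]
      rw [integral_const_mul]
      exact mul_le_mul_of_nonneg_left (hwsq k) (sq_nonneg _)
  -- Natural truncation levels make this a countable intersection of almost sure events.
  have key' := ae_all_iff.2 fun C => ae_all_iff.2 fun i => key C i
  filter_upwards [key', hbdd] with ω hω ⟨C, hC⟩
  obtain ⟨C', hC'⟩ := exists_nat_ge C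
  choose l hl using hω C'
  refine ⟨WithLp.toLp 2 l, ?_⟩
  refine (PiLp.continuous_toLp 2 (fun _ : Fin n => ℝ)).continuousAt.tendsto.comp
    (tendsto_pi_nhds.2 hl) |>.congr fun m => ?_
  ext i
  have : ∀ k, ω ∈ A C' k := fun k => (hC k).trans hC'
  simp [this, Set.indicator_of_mem]

end Noise

/-! ### Measurability of the iterates and the node filtrations. -/

section History

variable {Ω : Type*} {N n : ℕ}

/-- Only the initial `y` and the noise are assumed measurable. Measurability of the later iterates
is what makes the node histories sub-σ-fields, hence filtrations. -/
theorem IsDSAGD.measurable [MeasurableSpace Ω] {X : Fin N → Set (EuclideanSpace ℝ (Fin n))}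
    {Q : Matrix (Fin N) (Fin N) ℝ}
    {h : Fin N → EuclideanSpace ℝ (Fin n) → EuclideanSpace ℝ (Fin n)} {a b : ℕ → ℝ}
    {M z y : ℕ → Ω → Fin N → EuclideanSpace ℝ (Fin n)} (halg : IsDSAGD X Q h a b M z y)
    (hproj : ∀ i, Continuous (proj (X i))) (hh : ∀ i, Continuous (h i))
    (hy0 : ∀ i, Measurable fun ω => y 0 ω i) (hM : ∀ k i, Measurable fun ω => M (k + 1) ω i)
    (k : ℕ) : (∀ i, Measurable fun ω => z k ω i) ∧ ∀ i, Measurable fun ω => y k ω i := by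
  induction k with
  | zero => exact ⟨fun i => by simp only [halg.init]; exact measurable_const, hy0⟩
  | succ k ih =>
    obtain ⟨hz, hy⟩ := ih
    have hmix : ∀ u : Ω → Fin N → EuclideanSpace ℝ (Fin n), (∀ i, Measurable fun ω => u ω i) →
        ∀ i, Measurable fun ω => mix Q (u ω) i := fun u hu i =>
      Finset.measurable_fun_sum _ fun j _ => (hu j).const_smul (Q i j)
    have hzm := hmix _ hz
    have hym := hmix _ hy
    refine ⟨fun i => ?_, fun i => ?_⟩
    · have hzi := hzm i
      have hyi := hy i
      simp only [halg.fast]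
      refine (hproj i).measurable.comp (g := proj (X i)) ?_
      fun_prop
    · have hyi := hy i
      have hymi := hym i
      have hzi := hz i
      have hMi := hM k i
      have hhi : Measurable fun ω => h i (y k ω i) := (hh i).measurable.comp hyi
      simp only [halg.slow, slowStep]
      fun_prop

variable {M y : ℕ → Ω → Fin N → EuclideanSpace ℝ (Fin n)}

/-- The history of a node, as a filtration. -/
def nodeFiltration {m0 : MeasurableSpace Ω} (hy : ∀ k i, Measurable fun ω => y k ω i)
    (hM : ∀ k i, Measurable fun ω => M (k + 1) ω i) (i : Fin N) : Filtration ℕ m0 where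
  seq := nodeHistory M y i
  mono' := fun k l hkl => sup_le_sup
    (iSup_mono fun _ => iSup_mono' fun h => ⟨h.trans hkl, le_rfl⟩)
    (iSup_mono fun _ => iSup_mono' fun h => ⟨⟨h.1, h.2.trans hkl⟩, le_rfl⟩)
  le' := fun k => sup_le (iSup₂_le fun l _ => (hy l i).comap_le)
    -- The restriction `1 ≤ l` matters: nothing is assumed about `M 0`.
    (iSup₂_le fun l hl => by
      obtain ⟨l, rfl⟩ := Nat.exists_eq_add_of_le' hl.1
      exact (hM l i).comap_le)

theorem measurable_nodeHistory_state (i : Fin N) (k : ℕ) :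
    Measurable[nodeHistory M y i k] fun ω => y k ω i :=
  Measurable.of_comap_le (le_sup_of_le_left (le_iSup₂_of_le k le_rfl le_rfl))

theorem measurable_nodeHistory_noise (i : Fin N) (k : ℕ) :
    Measurable[nodeHistory M y i (k + 1)] fun ω => M (k + 1) ω i :=
  Measurable.of_comap_le
    (le_sup_of_le_right (le_iSup₂_of_le (k + 1) ⟨Nat.le_add_left 1 k, le_rfl⟩ le_rfl))

end History

/-! ### Both claims from the tracking theorem. -/

theorem mainTheorem4
    {Ω : Type*} [MeasurableSpace Ω] (μ : Measure Ω) [IsProbabilityMeasure μ]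
    (N n : ℕ) (hN : 0 < N)
    -- the constraint sets
    (X : Fin N → Set (EuclideanSpace ℝ (Fin n)))
    (hXconv : ∀ i, Convex ℝ (X i)) (hXcomp : ∀ i, IsCompact (X i))
    (hXint : (interior (⋂ i, X i)).Nonempty)
    -- the weight matrix
    (Q : Matrix (Fin N) (Fin N) ℝ) (hQ : Q ∈ doublyStochastic ℝ (Fin N))
    (hQirr : Q.IsIrreducible) (hQaper : IsAperiodicMatrix Q)
    -- the drift functions
    (h : Fin N → EuclideanSpace ℝ (Fin n) → EuclideanSpace ℝ (Fin n))
    (hLip : ∀ i, ∃ L : NNReal, LipschitzWith L (h i))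
    -- the step sizes
    (a b : ℕ → ℝ) (ha : ∀ k, 0 < a k) (hb : ∀ k, 0 < b k)
    (hab : a =o[atTop] b)
    (hasum : Tendsto (fun m => ∑ k ∈ Finset.range m, a k) atTop atTop)
    (hbsum : Tendsto (fun m => ∑ k ∈ Finset.range m, b k) atTop atTop)
    (hsq : Summable (fun k => a k ^ 2 + b k ^ 2))
    -- the algorithm
    (M z y : ℕ → Ω → Fin N → EuclideanSpace ℝ (Fin n))
    (halg : IsDSAGD X Q h a b M z y)
    (hy0 : ∀ i, Measurable (fun ω => y 0 ω i))
    -- the noise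
    (hMmeas : ∀ k i, Measurable (fun ω => M (k + 1) ω i))
    (hMint : ∀ k i, Integrable (fun ω => M (k + 1) ω i) μ)
    (hMmds : ∀ k i, μ[fun ω => M (k + 1) ω i | nodeHistory M y i k] =ᵐ[μ] 0)
    (K : ℝ) (hK : 0 < K)
    (hMvar : ∀ k i, ∀ᵐ ω ∂μ,
      condLExp (nodeHistory M y i k) μ (fun ω' => ‖M (k + 1) ω' i‖ₑ ^ 2) ω
        ≤ ENNReal.ofReal (K * (1 + ‖y k ω i‖ ^ 2)))
    -- stability
    (hbdd : ∀ᵐ ω ∂μ, ∃ C : ℝ, ∀ k i, ‖y k ω i‖ ≤ C) :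
    -- the fast iteration with frozen slow variable converges to the exact projection
    (∀ (ybar : EuclideanSpace ℝ (Fin n)) (ζ : ℕ → Fin N → EuclideanSpace ℝ (Fin n)),
      (∀ k, ζ (k + 1) = fastStep X Q (b k) (ζ k) (fun _ => ybar)) →
      ∀ i, Tendsto (fun k => ζ k i) atTop (𝓝 (proj (⋂ j, X j) ybar))) ∧
    -- the fast iterates track the projection of the average of the slow iterates
    (∀ᵐ ω ∂μ, ∀ i, Tendsto (fun k => ‖z k ω i - proj (⋂ j, X j) (nodeAvg (y k ω))‖)
      atTop (𝓝 0)) := by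
  have hprim := hQirr.isPrimitive hQaper
  have hh : ∀ i, Continuous (h i) := fun i => (hLip i).choose_spec.continuous
  have hsqb : Summable fun k => b k ^ 2 :=
    hsq.of_nonneg_of_le (fun _ => sq_nonneg _) fun k => le_add_of_nonneg_left (sq_nonneg _)
  have hsqa : Summable fun k => a k ^ 2 :=
    hsq.of_nonneg_of_le (fun _ => sq_nonneg _) fun k => le_add_of_nonneg_right (sq_nonneg _)
  have hb0 : Tendsto b atTop (𝓝 0) := by
    simpa [Real.sqrt_sq (hb _).le] using hsqb.tendsto_atTop_zero.sqrt
  have ha0 : Tendsto a atTop (𝓝 0) := by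
    simpa [Real.sqrt_sq (ha _).le] using hsqa.tendsto_atTop_zero.sqrt
  have hne : (⋂ i, X i).Nonempty := hXint.mono interior_subset
  refine ⟨fun ybar ζ hζ i => ?_, ?_⟩
  · rw [tendsto_iff_norm_sub_tendsto_zero]
    exact tendsto_norm_sub_proj_of_slow_target (x := fun _ => ybar) (C := ‖ybar‖) hN hXconv hXcomp
      hXint hQ hprim hb hb0 hbsum hζ (.of_forall fun _ => le_rfl) (fun _ => by simp)
      (by simp) i
  · have hproj : ∀ i, Continuous (proj (X i)) := fun i =>
      continuous_proj (hne.mono (Set.iInter_subset _ i)) (hXconv i) (hXcomp i).isClosed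
    have hy : ∀ k i, Measurable fun ω => y k ω i := fun k =>
      (halg.measurable hproj hh hy0 hMmeas k).2
    -- Each node has its own filtration, so convergence is proved node by node and only then
    -- assembled pathwise into a stacked limit.
    have hnoise : ∀ i, ∀ᵐ ω ∂μ, ∃ l,
        Tendsto (fun m => ∑ k ∈ Finset.range m, a k • M (k + 1) ω i) atTop (𝓝 l) := fun i =>
      ae_exists_tendsto_sum_smul_noise (nodeFiltration hy hMmeas i) hK.le hsqa
        (fun k => (measurable_nodeHistory_state i k).stronglyMeasurable)
        (fun k => (measurable_nodeHistory_noise i k).stronglyMeasurable)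
        (fun k => hMint k i) (fun k => hMmds k i) (fun k => hMvar k i)
        (hbdd.mono fun ω ⟨C, hC⟩ => ⟨C, fun k => hC k i⟩)
    filter_upwards [ae_all_iff.2 hnoise, hbdd] with ω hω ⟨C, hC⟩ i
    choose l hl using hω
    refine tendsto_norm_sub_proj_nodeAvg (z := fun k => z k ω) (y := fun k => y k ω)
      (m := fun k => M k ω) hN hXconv hXcomp hXint hQ hprim hh hb hb0 ha0 hab hbsum
      (fun k => halg.fast k ω) (fun k => halg.slow k ω) hC ⟨l, tendsto_pi_nhds.2 fun j => ?_⟩ i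
    simpa only [Finset.sum_apply, Pi.smul_apply] using hl j
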